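/- **Proposition 4.** Fix a set $B$ of bodies with subsets $IOb$ (inertial observers) and $Ph$ (light signals), an ordered field $Q$, and a relation $W(o,b,\bar x)$ for $o,b\in B$, $\bar x\in Q^4$ ("observer $o$ coordinatizes body $b$ at $\bar x$"), where $x_1,x_2,x_3$ are the space coordinates and $x_4$ is the time coordinate of $\bar x$. Put $ev_o(\bar x)=\{b: W(o,b,\bar x)\}$, $wline_o(b)=\{\bar x: W(o,b,\bar x)\}$, $dist(\bar x,\bar y)=\sqrt{(x_1-y_1)^2+(x_2-y_2)^2+(x_3-y_3)^2}$, $time(\bar x,\bar y)=|x_4-y_4|$, and write $w_{oo'}(\bar x)=\bar x'$ iff $ev_o(\bar x)=ev_{o'}(\bar x')$. If $wline_i(b)$ is contained in a line, write $v_i(b)=v$ iff there are distinct $\bar x,\bar y\in wline_i(b)$ with $dist(\bar x,\bar y)=v\cdot time(\bar x,\bar y)$. Assume $SpecRel_0$, that is: * $AxEField$: $Q$ is a Euclidean field (an ordered field in which every positive element is a square); * $AxPh$: for every $i\in IOb$ there is $c_i\in Q$, $c_i>0$, such that for all $\bar x,\bar y\in Q^4$: there is $p\in Ph$ with $\bar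 x,\bar y\in wline_i(p)$ if and only if $dist(\bar x,\bar y)=c_i\cdot time(\bar x,\bar y)$; * $AxEv$: for all $i,i'\in IOb$ and $\bar x\in Q^4$ there is $\bar x'\in Q^4$ with $ev_i(\bar x)=ev_{i'}(\bar x')$; * $AxSelf$: for all $i\in IOb$ and $\bar x\in Q^4$: $\bar x\in wline_i(i)$ if and only if $x_1=x_2=x_3=0$. Assume moreover $Ax(c_i=c_j)$: $v_i(p)=v_j(p)$ for all $i,j\in IOb$ and $p\in Ph$ (if either side is defined, so is the other and they are equal). Then the following are equivalent: * $AxSymTime$: for all $i,i'\in IOb$ and $t\in Q$, $time\big(w_{ii'}(t\cdot\bar 1_t),w_{ii'}(\bar o)\big)=time\big(w_{i'i}(t\cdot\bar 1_t),w_{i'i}(\bar o)\big)$, where $\bar o=(0,0,0,0)$ and $\bar 1_t=(0,0,0,1)$; * $AxSymDist$: for all $i,i'\in IOb$ and $\bar x,\bar y,\bar x',\bar y'\in Q^4$ with $ev_i(\bar x)=ev_{i'}(\bar x')$, $ev_i(\bar y)=ev_{i'}(\bar y')$, $time(\bar x,\bar y)=0$ and $time(\bar x',\bar y')=0$, one has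 $dist(\bar x,\bar y)=dist(\bar x',\bar y')$. (Under $SpecRel_0$ the relations $w_{ii'}$, $i,i'\in IOb$, are functions on $Q^4$.) -/

import Mathlib

namespace SpecRel

/-- Every positive quantity has a square root. For an ordered field `Q` this says that
`Q` is a Euclidean field. -/
def AxEField (Q : Type*) [Field Q] [LinearOrder Q] : Prop :=
  ∀ x : Q, 0 < x → ∃ y : Q, x = y ^ 2

open Classical in
/-- The nonnegative square root in an ordered field (`0` if there is none). -/
noncomputable def sqrt {Q : Type*} [Field Q] [LinearOrder Q] (a : Q) : Q :=
  if h : ∃ y : Q, 0 ≤ y ∧ y ^ 2 = a then h.choose else 0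

/-- In a Euclidean field `sqrt a` is the nonnegative square root of any `a ≥ 0`. -/
theorem sqrt_spec {Q : Type*} [Field Q] [LinearOrder Q] [IsStrictOrderedRing Q]
    (hQ : AxEField Q) {a : Q} (ha : 0 ≤ a) : 0 ≤ sqrt a ∧ sqrt a ^ 2 = a := by
  have h : ∃ y : Q, 0 ≤ y ∧ y ^ 2 = a := by
    rcases ha.eq_or_lt with rfl | ha
    · exact ⟨0, le_rfl, by simp⟩
    · obtain ⟨y, hy⟩ := hQ a ha
      exact ⟨|y|, abs_nonneg y, by rw [sq_abs, hy]⟩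
  unfold sqrt
  rw [dif_pos h]
  exact h.choose_spec

/-- Coordinate points `(x, y, z, t)`: indices `0, 1, 2` are the space coordinates,
index `3` is the time coordinate. -/
abbrev Coord (Q : Type*) : Type _ := Fin 4 → Q

section Coordinates

variable {Q : Type*} [Field Q] [LinearOrder Q]

/-- Spatial distance of two coordinate points. -/
noncomputable def dist (x y : Coord Q) : Q :=
  sqrt ((x 0 - y 0) ^ 2 + (x 1 - y 1) ^ 2 + (x 2 - y 2) ^ 2)

/-- Time difference of two coordinate points. -/
def time (x y : Coord Q) : Q := |x 3 - y 3|

/-- The unit vector `(0, 0, 0, 1)` of the time axis. -/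
def oneT : Coord Q := ![0, 0, 0, 1]

end Coordinates

/-- The basic (non-logical) concepts over bodies `B` and quantities `Q`: inertial observers,
light signals, and the worldview relation `W o b x`, "observer `o` coordinatizes body `b`
at the coordinate point `x`". -/
structure Frame (B Q : Type*) where
  IOb : Set B
  Ph : Set B
  W : B → B → Coord Q → Prop

namespace Frame

variable {B Q : Type*} (M : Frame B Q)

/-- The event coordinatized by `o` at `x`. -/
def ev (o : B) (x : Coord Q) : Set B := {b | M.W o b x}

/-- The worldline of `b` according to `o`. -/
def wline (o b : B) : Set (Coord Q) := {x | M.W o b x}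

/-- The worldview transformation `w_{oo'}` as a binary relation: `M.wvt o o' x x'` means
`w_{oo'}(x) = x'`. -/
def wvt (o o' : B) (x x' : Coord Q) : Prop := M.ev o x = M.ev o' x'

/-- Inertial observers coordinatize the same events. -/
def AxEv : Prop :=
  ∀ i ∈ M.IOb, ∀ i' ∈ M.IOb, ∀ x : Coord Q, ∃ x' : Coord Q, M.ev i x = M.ev i' x'

variable [Field Q] [LinearOrder Q]

/-- Inertial observers are stationary in the origin of their own coordinate systems. -/
def AxSelf : Prop :=
  ∀ i ∈ M.IOb, ∀ x : Coord Q, x ∈ M.wline i i ↔ x 0 = 0 ∧ x 1 = 0 ∧ x 2 = 0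

/-- For every inertial observer there is a (positive, finite) speed `c` such that two
coordinate points lie on the worldline of a light signal iff they are related by speed `c`. -/
def AxPh : Prop :=
  ∀ i ∈ M.IOb, ∃ c : Q, 0 < c ∧ ∀ x y : Coord Q,
    (∃ p ∈ M.Ph, x ∈ M.wline i p ∧ y ∈ M.wline i p) ↔ dist x y = c * time x y

/-- `M.HasSpeed i b v` means `v_i(b) = v`: the worldline of `b` according to `i` lies on a
line, and some (hence any) two distinct points of it are related by speed `v`. -/
def HasSpeed (i b : B) (v : Q) : Prop :=
  Collinear Q (M.wline i b) ∧
    ∃ x ∈ M.wline i b, ∃ y ∈ M.wline i b, x ≠ y ∧ dist x y = v * time x y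

/-- The speed of every light signal is the same for all inertial observers. The equation
`v_i(p) = v_j(p)` is between partially defined terms: one side is defined iff the other is,
and then the values agree. -/
def AxSameC : Prop :=
  ∀ i ∈ M.IOb, ∀ j ∈ M.IOb, ∀ p ∈ M.Ph, ∀ v : Q, M.HasSpeed i p v ↔ M.HasSpeed j p v

/-- The axiom system `SpecRel₀` (`Q` being an ordered field is given by the instances). -/
structure SpecRel0 : Prop where
  axPh : M.AxPh
  axEField : AxEField Q
  axEv : M.AxEv
  axSelf : M.AxSelf

/-- Inertial observers agree on the spatial distance of events that are simultaneous
for both of them. -/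
def AxSymDist : Prop :=
  ∀ i ∈ M.IOb, ∀ i' ∈ M.IOb, ∀ x y x' y' : Coord Q,
    M.ev i x = M.ev i' x' → M.ev i y = M.ev i' y' →
    time x y = 0 → time x' y' = 0 → dist x y = dist x' y'

/-- Any two inertial observers see each other's clocks slowed down with the same rate:
`time (w_{ii'}(t·1ₜ), w_{ii'}(0)) = time (w_{i'i}(t·1ₜ), w_{i'i}(0))`. -/
def AxSymTime : Prop :=
  ∀ i ∈ M.IOb, ∀ i' ∈ M.IOb, ∀ t : Q, ∀ a b a' b' : Coord Q,
    M.wvt i i' (t • oneT) a → M.wvt i i' 0 b →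
    M.wvt i' i (t • oneT) a' → M.wvt i' i 0 b' →
    time a b = time a' b'

end Frame

end SpecRel

/-!
Put the worldview transformation `w` between two observers on the form
`x₀² + x₁² + x₂² - c² x₃²`: by `AxPh` and the common speed of light it preserves the relation of
being joined by a null vector. As in the Alexandrov–Zeeman theorem, such a bijection has an additive
linear part `g`, and `⟪g x, g y⟫ = κ ψ ⟪x, y⟫` for a scalar `κ ≠ 0` and a field endomorphism `ψ`.
This part needs only that orthogonal null vectors are parallel and that there are three null vectors
with equal nonzero products.

Over a Euclidean field `ψ` is increasing. Both symmetry axioms for `w` hold iff `ψ = id` and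
`κ = 1`. For distances, displacements simultaneous for both observers have arbitrary positive square
length `r`, so preserving them means `κ ψ r = r`. For times, compose the dilation of one observer
with that of the other: symmetry makes the increasing map `ψ` an involution. Conversely, an isometry
`g` satisfies `⟪g e, e⟫ = ⟪e, g⁻¹ e⟫` for the time unit vector `e`, so both dilations agree.
-/

namespace SpecRel

section Lorentzian

variable {K V : Type*} [Field K] [AddCommGroup V] [Module K V] {B : LinearMap.BilinForm K V}

/-- Three null vectors whose mutual products are equal and nonzero. In characteristic other than two
they span a three-dimensional nondegenerate subspace. -/
structure NullTriple (B : LinearMap.BilinForm K V) (u v w : V) : Prop where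
  null_fst : B u u = 0
  null_snd : B v v = 0
  null_trd : B w w = 0
  ne_zero : B u v ≠ 0
  fst_trd : B u w = B u v
  snd_trd : B v w = B u v

/-- A symmetric bilinear form of Witt index one in dimension at least three. The dimension is
encoded by the presence of a null triple, the Witt index by orthogonal null vectors being
parallel; together they force nondegeneracy. -/
structure IsLorentzian (B : LinearMap.BilinForm K V) : Prop where
  isSymm : B.IsSymm
  exists_eq_smul : ∀ u v, u ≠ 0 → B u u = 0 → B v v = 0 → B v u = 0 → ∃ s : K, v = s • u
  exists_nullTriple : ∃ u v w, NullTriple B u v w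

theorem apply_add_smul_self (hB : B.IsSymm) {u : V} (hu : B u u = 0) (x : V) (s : K) :
    B (x + s • u) (x + s • u) = B x x + 2 * s * B x u := by
  simp only [map_add, map_smul, LinearMap.add_apply, LinearMap.smul_apply, smul_eq_mul, hu,
    hB.eq u x]
  ring

theorem apply_sub_self (hB : B.IsSymm) (x y : V) :
    B (x - y) (x - y) = B x x - 2 * B x y + B y y := by
  simp only [map_sub, LinearMap.sub_apply, hB.eq y x]
  ring

namespace NullTriple

variable {u v w : V}

theorem rotate (hB : B.IsSymm) (h : NullTriple B u v w) : NullTriple B v w u where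
  null_fst := h.null_snd
  null_snd := h.null_trd
  null_trd := h.null_fst
  ne_zero := h.snd_trd ▸ h.ne_zero
  fst_trd := by rw [hB.eq v u, h.snd_trd]
  snd_trd := by rw [hB.eq w u, h.fst_trd, h.snd_trd]

theorem fst_ne_zero (h : NullTriple B u v w) : u ≠ 0 := by
  rintro rfl
  exact h.ne_zero (by simp)

theorem apply_combination_self (hB : B.IsSymm) (h : NullTriple B u v w) (a b c : K) :
    B (a • u + b • v + c • w) (a • u + b • v + c • w) = 2 * B u v * (a * b + a * c + b * c) := by
  simp only [map_add, map_smul, LinearMap.add_apply, LinearMap.smul_apply, smul_eq_mul,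
    hB.eq v u, hB.eq w u, hB.eq w v, h.null_fst, h.null_snd, h.null_trd, h.fst_trd, h.snd_trd]
  ring

theorem apply_combination_fst (hB : B.IsSymm) (h : NullTriple B u v w) (a b c : K) :
    B (a • u + b • v + c • w) u = (b + c) * B v u := by
  simp only [map_add, map_smul, LinearMap.add_apply, LinearMap.smul_apply, smul_eq_mul,
    hB.eq v u, hB.eq w u, h.null_fst, h.fst_trd]
  ring

end NullTriple

namespace IsLorentzian

/-- At least two members of any triple are not orthogonal to `u`, and these two can be rescaled so
as to form a triple with `u`. -/
theorem exists_nullTriple_of_null (hB : IsLorentzian B) {u : V} (hu : B u u = 0) (hu0 : u ≠ 0) :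
    ∃ v w, NullTriple B u v w := by
  obtain ⟨p, q, hp, hq, hpq, hpu, hqu⟩ :
      ∃ p q, B p p = 0 ∧ B q q = 0 ∧ B p q ≠ 0 ∧ B p u ≠ 0 ∧ B q u ≠ 0 := by
    have not_both {p q : V} (hp : B p p = 0) (hpq : B p q ≠ 0) (hpu : B p u = 0) : B q u ≠ 0 := by
      obtain ⟨s, rfl⟩ := hB.exists_eq_smul u p hu0 hu hp hpu
      rw [hB.isSymm.eq]
      exact fun h => hpq (by simp [h])
    obtain ⟨p, q, r, h⟩ := hB.exists_nullTriple
    have h' := h.rotate hB.isSymm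
    have h'' := h'.rotate hB.isSymm
    by_cases hpu : B p u = 0
    · exact ⟨q, r, h.null_snd, h.null_trd, h'.ne_zero, not_both h.null_fst h.ne_zero hpu,
        not_both h.null_fst (h.fst_trd ▸ h.ne_zero) hpu⟩
    · by_cases hqu : B q u = 0
      · exact ⟨r, p, h.null_trd, h.null_fst, h''.ne_zero, not_both h.null_snd h'.ne_zero hqu, hpu⟩
      · exact ⟨p, q, h.null_fst, h.null_snd, h.ne_zero, hpu, hqu⟩
  refine ⟨(B q u / B p q) • p, (B p u / B p q) • q, ?_, ?_, ?_, ?_, ?_, ?_⟩ <;>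
    simp only [map_smul, LinearMap.smul_apply, smul_eq_mul, hB.isSymm.eq u p, hB.isSymm.eq u q,
      hu, hp, hq, mul_zero]
  · exact mul_ne_zero (div_ne_zero hqu hpq) hpu
  · ring
  · field_simp

theorem exists_null_apply_ne_zero (hB : IsLorentzian B) {u : V} (hu : B u u = 0) (hu0 : u ≠ 0) :
    ∃ v, B v v = 0 ∧ B v u ≠ 0 := by
  obtain ⟨v, w, h⟩ := hB.exists_nullTriple_of_null hu hu0
  exact ⟨v, h.null_snd, hB.isSymm.eq u v ▸ h.ne_zero⟩

variable [NeZero (2 : K)]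

theorem exists_null_add_smul (hB : IsLorentzian B) {u : V} (hu : B u u = 0) {x : V}
    (hx : B x u ≠ 0) : ∃ s : K, B (x + s • u) (x + s • u) = 0 := by
  refine ⟨-B x x / (2 * B x u), ?_⟩
  rw [apply_add_smul_self hB.isSymm hu]
  field_simp
  ring

@[elab_as_elim]
theorem induction_null (hB : IsLorentzian B) {u : V} (hu : B u u = 0) (hu0 : u ≠ 0)
    {motive : V → Prop} (null : ∀ n, B n n = 0 → B n u ≠ 0 → motive n)
    (add : ∀ x y, motive x → motive y → motive (x + y))
    (neg : ∀ x, motive x → motive (-x)) (x : V) : motive x := by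
  obtain ⟨v, w, h⟩ := hB.exists_nullTriple_of_null hu hu0
  have hvu : B v u ≠ 0 := hB.isSymm.eq u v ▸ h.ne_zero
  have hwu : B w u = B v u := by rw [hB.isSymm.eq w u, hB.isSymm.eq v u, h.fst_trd]
  have motive_v := null v h.null_snd hvu
  have motive_smul (s : K) : motive (s • u) := by
    rcases eq_or_ne s 0 with rfl | hs
    · simpa using add _ _ motive_v (neg _ motive_v)
    have motive_smul_null {n : V} (hn : B n n = 0) (hnu : B n u = B v u) {r : K} (hr : r ≠ 0) :
        motive (r • n) :=
      null _ (by simp [hn]) (by simp [hnu, hr, hvu])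
    have hs2 : s / 2 ≠ 0 := div_ne_zero hs two_ne_zero
    set n := (2 : K) • u + (2 : K) • v + (-1 : K) • w with hn_def
    have hn : B n n = 0 := by rw [h.apply_combination_self hB.isSymm]; ring
    have hnu : B n u = B v u := by rw [h.apply_combination_fst hB.isSymm]; ring
    have decomposition : s • u = (s / 2) • n + (-s) • v + (s / 2) • w := by
      rw [hn_def]
      match_scalars <;> field_simp <;> ring
    rw [decomposition]
    exact add _ _ (add _ _ (motive_smul_null hn hnu hs2)
      (motive_smul_null h.null_snd rfl (neg_ne_zero.2 hs))) (motive_smul_null h.null_trd hwu hs2)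
  have motive_of_ne {x : V} (hx : B x u ≠ 0) : motive x := by
    obtain ⟨s, hs⟩ := hB.exists_null_add_smul hu hx
    simpa using add _ _ (null (x + s • u) hs (by simpa [hu] using hx)) (neg _ (motive_smul s))
  by_cases hx : B x u = 0
  · simpa using add _ _ (motive_of_ne (x := x + v) (by simpa [hx] using hvu)) (neg _ motive_v)
  · exact motive_of_ne hx

theorem exists_eq_smul_of_null_sub (hB : IsLorentzian B) {u x : V} (hu : B u u = 0) (hu0 : u ≠ 0)
    (hx : B x x = 0) (hxu : B (x - u) (x - u) = 0) : ∃ s : K, x = s • u := by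
  refine hB.exists_eq_smul u x hu0 hu hx ?_
  rw [apply_sub_self hB.isSymm, hx, hu] at hxu
  simpa [two_ne_zero] using hxu

theorem eq_of_forall_null (hB : IsLorentzian B) {x y : V}
    (h : ∀ z, B (z - x) (z - x) = 0 → B (z - y) (z - y) = 0) : x = y := by
  by_contra hne
  have hxy : B (x - y) (x - y) = 0 := h x (by simp)
  obtain ⟨n, hn, hnd⟩ := hB.exists_null_apply_ne_zero hxy (sub_ne_zero.2 hne)
  have hcone := h (x + n) (by simpa using hn)
  rw [show x + n - y = (x - y) + (1 : K) • n by module, apply_add_smul_self hB.isSymm hn, hxy,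
    hB.isSymm.eq, zero_add, mul_one] at hcone
  exact mul_ne_zero two_ne_zero hnd hcone

end IsLorentzian

/-- A bijection that preserves and reflects the relation of being joined by a null vector. -/
def PreservesNull (B : LinearMap.BilinForm K V) (f : V ≃ V) : Prop :=
  ∀ x y, B (f x - f y) (f x - f y) = 0 ↔ B (x - y) (x - y) = 0

namespace PreservesNull

variable {f : V ≃ V} {u v : V}

theorem symm (hf : PreservesNull B f) : PreservesNull B f.symm := fun x y => by
  simpa using (hf (f.symm x) (f.symm y)).symm

theorem null_image_sub (hf : PreservesNull B f) (hu : B u u = 0) (a : V) :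
    B (f (a + u) - f a) (f (a + u) - f a) = 0 :=
  (hf _ _).2 (by simpa using hu)

theorem image_sub_ne_zero (f : V ≃ V) (hu : u ≠ 0) (a : V) : f (a + u) - f a ≠ 0 :=
  sub_ne_zero.2 (f.injective.ne (by simpa using hu))

theorem map_null_iff {g : V ≃+ V} (hg : PreservesNull B g.toEquiv) (x : V) :
    B (g x) (g x) = 0 ↔ B x x = 0 := by
  simpa using hg x 0

variable [NeZero (2 : K)]

theorem exists_image_add_smul (hB : IsLorentzian B) (hf : PreservesNull B f) (hu : B u u = 0)
    (hu0 : u ≠ 0) (a : V) (s : K) : ∃ r : K, f (a + s • u) = f a + r • (f (a + u) - f a) := by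
  obtain ⟨r, hr⟩ := hB.exists_eq_smul_of_null_sub (hf.null_image_sub hu a)
    (image_sub_ne_zero f hu0 a) (hf.null_image_sub (u := s • u) (by simp [hu]) a) (by
      rw [sub_sub_sub_cancel_right, hf, add_sub_add_left_eq_sub,
        show s • u - u = (s - 1) • u by module]
      simp [hu])
  exact ⟨r, by rw [← hr, add_sub_cancel]⟩

theorem exists_add_smul_image (hB : IsLorentzian B) (hf : PreservesNull B f) (hu : B u u = 0)
    (hu0 : u ≠ 0) (a : V) (r : K) : ∃ s : K, f (a + s • u) = f a + r • (f (a + u) - f a) := by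
  obtain ⟨s, hs⟩ := hf.symm.exists_image_add_smul hB (hf.null_image_sub hu a)
    (image_sub_ne_zero f hu0 a) (f a) r
  rw [add_sub_cancel, f.symm_apply_apply, f.symm_apply_apply, add_sub_cancel_left] at hs
  exact ⟨s, (f.symm_apply_eq.1 hs).symm⟩

/-- If the image lines were not parallel, some point of the first would be joined by null vectors
either to all points of the second or to none; every point of `a + K u` is joined to exactly one
point of `b + K u`. -/
theorem exists_smul_of_apply_ne_zero (hB : IsLorentzian B) (hf : PreservesNull B f)
    (hu : B u u = 0) (hu0 : u ≠ 0) {a b : V} (hab : B (a - b) u ≠ 0) :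
    ∃ k : K, f (a + u) - f a = k • (f (b + u) - f b) := by
  set m := f (a + u) - f a
  set n := f (b + u) - f b with hn_def
  have hn : B n n = 0 := hf.null_image_sub hu b
  refine hB.exists_eq_smul n m (image_sub_ne_zero f hu0 b) hn (hf.null_image_sub hu a) ?_
  by_contra hmn
  obtain ⟨t, ht⟩ := hf.exists_add_smul_image hB hu hu0 a (-B (f a - f b) n / B m n)
  have orthogonal : B (f (a + t • u) - f b) n = 0 := by
    rw [ht, add_sub_right_comm, map_add, map_smul, LinearMap.add_apply, LinearMap.smul_apply,
      smul_eq_mul, div_mul_cancel₀ _ hmn, add_neg_cancel]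
  have null_iff (s : K) : B (a + t • u - (b + s • u)) (a + t • u - (b + s • u)) = 0 ↔
      B (f (a + t • u) - f b) (f (a + t • u) - f b) = 0 := by
    obtain ⟨r, hr⟩ := hf.exists_image_add_smul hB hu hu0 b s
    rw [← hf, hr, ← hn_def, show ∀ x : V, x - (f b + r • n) = (x - f b) + (-r) • n by intro; module,
      apply_add_smul_self hB.isSymm hn, orthogonal, mul_zero, add_zero]
  have expand (s : K) : B (a + t • u - (b + s • u)) (a + t • u - (b + s • u)) =
      B (a - b) (a - b) + 2 * (t - s) * B (a - b) u := by
    rw [← apply_add_smul_self hB.isSymm hu,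
      show a + t • u - (b + s • u) = (a - b) + (t - s) • u by module]
  obtain ⟨s, hs⟩ := hB.exists_null_add_smul hu hab
  rw [apply_add_smul_self hB.isSymm hu] at hs
  have h₀ : B (a + t • u - (b + (t - s) • u)) (a + t • u - (b + (t - s) • u)) = 0 := by
    rw [expand, sub_sub_cancel, hs]
  have h₁ := (null_iff (t - s - 1)).2 ((null_iff (t - s)).1 h₀)
  rw [expand] at h₁
  refine mul_ne_zero two_ne_zero hab ?_
  linear_combination h₁ - hs

theorem exists_smul (hB : IsLorentzian B) (hf : PreservesNull B f) (hu : B u u = 0) (hu0 : u ≠ 0)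
    (a b : V) : ∃ k : K, f (a + u) - f a = k • (f (b + u) - f b) := by
  by_cases hab : B (a - b) u = 0
  · obtain ⟨v, -, hvu⟩ := hB.exists_null_apply_ne_zero hu hu0
    obtain ⟨k, hk⟩ := hf.exists_smul_of_apply_ne_zero hB hu hu0 (a := a) (b := a + v)
      (by simpa using hvu)
    obtain ⟨l, hl⟩ := hf.exists_smul_of_apply_ne_zero hB hu hu0 (a := a + v) (b := b)
      (by rwa [add_sub_right_comm, map_add, LinearMap.add_apply, hab, zero_add])
    exact ⟨k * l, by rw [hk, hl, smul_smul]⟩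
  · exact hf.exists_smul_of_apply_ne_zero hB hu hu0 hab

theorem image_add_add_sub (hB : IsLorentzian B) (hf : PreservesNull B f) (hu : B u u = 0)
    (hv : B v v = 0) (huv : B u v ≠ 0) (a : V) :
    f (a + v + u) - f (a + v) = f (a + u) - f a := by
  have hu0 : u ≠ 0 := by rintro rfl; simp at huv
  have hv0 : v ≠ 0 := by rintro rfl; simp at huv
  set p := f (a + u) - f a with hp_def
  set q := f (a + v) - f a with hq_def
  have hp : B p p = 0 := hf.null_image_sub hu a
  have hq : B q q = 0 := hf.null_image_sub hv a
  have hpq : B p q ≠ 0 := fun h => by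
    have hsub : B (p - q) (p - q) = 0 := by rw [apply_sub_self hB.isSymm, hp, hq, h]; ring
    rw [sub_sub_sub_cancel_right, hf, add_sub_add_left_eq_sub, apply_sub_self hB.isSymm, hu, hv]
      at hsub
    simp [two_ne_zero, huv] at hsub
  obtain ⟨k, hk⟩ := hf.exists_smul hB hu hu0 (a + v) a
  obtain ⟨l, hl⟩ := hf.exists_smul hB hv hv0 (a + u) a
  rw [← hp_def] at hk
  rw [← hq_def, add_right_comm] at hl
  have closing : (k - 1) • p = (l - 1) • q := by
    rw [sub_smul, sub_smul, ← hk, ← hl, one_smul, one_smul, hp_def, hq_def]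
    abel
  have hk1 : (k - 1) * B p q = 0 := by
    simpa [hq] using congrArg (fun x => B x q) closing
  rw [hk, sub_eq_zero.1 ((mul_eq_zero.1 hk1).resolve_right hpq), one_smul]

theorem image_add_sub_of_null (hB : IsLorentzian B) (hf : PreservesNull B f) (hu : B u u = 0)
    (hu0 : u ≠ 0) (x : V) : ∀ a, f (a + x + u) - f (a + x) = f (a + u) - f a := by
  induction x using hB.induction_null hu hu0 with
  | null n hn hnu => exact hf.image_add_add_sub hB hu hn (hB.isSymm.eq u n ▸ hnu)
  | add x y hx hy => exact fun a => by rw [← add_assoc, hy, hx]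
  | neg x hx => exact fun a => by simpa using (hx (a + -x)).symm

theorem image_add_sub (hB : IsLorentzian B) (hf : PreservesNull B f) (x : V) :
    ∀ a, f (a + x) - f a = f x - f 0 := by
  obtain ⟨u, v, w, h⟩ := hB.exists_nullTriple
  induction x using hB.induction_null h.null_fst h.fst_ne_zero with
  | null n hn hnu =>
    intro a
    have hn0 : n ≠ 0 := by rintro rfl; simp at hnu
    simpa using hf.image_add_sub_of_null hB hn hn0 a 0
  | add x y hx hy =>
    intro a
    rw [← add_assoc, ← sub_add_sub_cancel (f (a + x + y)) (f (a + x)), hy, hx,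
      ← sub_add_sub_cancel (f (x + y)) (f x), hy]
  | neg x hx =>
    intro a
    have h₁ := hx (a + -x)
    have h₂ := hx (-x)
    rw [neg_add_cancel_right] at h₁
    rw [neg_add_cancel] at h₂
    rw [← neg_sub, h₁, ← h₂, neg_sub]

theorem exists_addEquiv (hB : IsLorentzian B) (hf : PreservesNull B f) :
    ∃ g : V ≃+ V, ∀ x y, f x - f y = g (x - y) := by
  refine ⟨AddEquiv.mk' (f.trans (Equiv.subRight (f 0))) fun x y => ?_, fun x y => ?_⟩
  · change f (x + y) - f 0 = (f x - f 0) + (f y - f 0)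
    rw [← hf.image_add_sub hB y x]
    abel
  · change f x - f y = f (x - y) - f 0
    simpa using hf.image_add_sub hB (x - y) y

section AddEquiv

variable {g : V ≃+ V} {w : V} {ψ : K →+* K}

theorem exists_map_smul (hB : IsLorentzian B) (hg : PreservesNull B g.toEquiv) (hu : B u u = 0)
    (hu0 : u ≠ 0) (s : K) : ∃ r : K, g (s • u) = r • g u := by
  simpa using hg.exists_image_add_smul hB hu hu0 0 s

theorem apply_eq_zero_of_map (hB : IsLorentzian B) (hg : PreservesNull B g.toEquiv)
    (hu : B u u = 0) {x : V} (h : B (g x) (g u) = 0) : B x u = 0 := by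
  by_contra hxu
  have hu0 : u ≠ 0 := by rintro rfl; simp at hxu
  have hgu : B (g u) (g u) = 0 := (hg.map_null_iff u).2 hu
  obtain ⟨s, hy⟩ := hB.exists_null_add_smul hu hxu
  obtain ⟨k, hk⟩ := hg.exists_map_smul hB hu hu0 s
  have hgy : B (g (x + s • u)) (g u) = 0 := by simp [hk, h, hgu]
  have hgyu : B (g (x + s • u + u)) (g (x + s • u + u)) = 0 := by
    have := apply_add_smul_self hB.isSymm hgu (g (x + s • u)) 1
    rwa [one_smul, ← map_add, hgy, (hg.map_null_iff _).2 hy, mul_zero, add_zero] at this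
  have hyu := apply_add_smul_self hB.isSymm hu (x + s • u) 1
  rw [one_smul, (hg.map_null_iff _).1 hgyu, hy] at hyu
  simp [hu, hxu, two_ne_zero] at hyu

theorem apply_map_eq_zero_iff (hB : IsLorentzian B) (hg : PreservesNull B g.toEquiv)
    (hu : B u u = 0) {x : V} : B (g x) (g u) = 0 ↔ B x u = 0 := by
  refine ⟨hg.apply_eq_zero_of_map hB hu, fun h => ?_⟩
  have hg' : PreservesNull B g.symm.toEquiv := hg.symm
  exact hg'.apply_eq_zero_of_map hB ((hg.map_null_iff u).2 hu) (by simpa using h)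

theorem apply_map_congr (hB : IsLorentzian B) (hg : PreservesNull B g.toEquiv)
    (hw : B w w = 0) (h : B u w = B v w) : B (g u) (g w) = B (g v) (g w) := by
  rw [← sub_eq_zero, ← LinearMap.sub_apply, ← map_sub, ← map_sub, hg.apply_map_eq_zero_iff hB hw]
  simp [h]

theorem map_smul_congr (hB : IsLorentzian B) (hg : PreservesNull B g.toEquiv) (hv : B v v = 0)
    (hw : B w w = 0) (h : B v w = B u w) (h0 : B u w ≠ 0) {s k : K} (hk : g (s • u) = k • g u) :
    g (s • v) = k • g v := by
  have hv0 : v ≠ 0 := by rintro rfl; exact h0 (by simpa using h.symm)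
  obtain ⟨l, hl⟩ := hg.exists_map_smul hB hv hv0 s
  have hgs := hg.apply_map_congr hB hw (u := s • v) (v := s • u) (by simp [h])
  rw [hl, hk, map_smul, map_smul, LinearMap.smul_apply, LinearMap.smul_apply,
    hg.apply_map_congr hB hw h] at hgs
  rw [hl, smul_left_injective K ((hg.apply_map_eq_zero_iff hB hw).not.2 h0) hgs]

theorem nullTriple_map (hB : IsLorentzian B) (hg : PreservesNull B g.toEquiv)
    (h : NullTriple B u v w) : NullTriple B (g u) (g v) (g w) where
  null_fst := (hg.map_null_iff u).2 h.null_fst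
  null_snd := (hg.map_null_iff v).2 h.null_snd
  null_trd := (hg.map_null_iff w).2 h.null_trd
  ne_zero := (hg.apply_map_eq_zero_iff hB h.null_snd).not.2 h.ne_zero
  fst_trd := by
    rw [hB.isSymm.eq, hB.isSymm.eq (g u)]
    exact hg.apply_map_congr hB h.null_fst (by rw [hB.isSymm.eq w, hB.isSymm.eq v, h.fst_trd])
  snd_trd := by
    rw [hB.isSymm.eq]
    exact hg.apply_map_congr hB h.null_snd (by rw [hB.isSymm.eq w, h.snd_trd])

theorem exists_addMonoidHom (hB : IsLorentzian B) (hg : PreservesNull B g.toEquiv) (hu : B u u = 0)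
    (hu0 : u ≠ 0) : ∃ ψ : K →+ K, ψ 1 = 1 ∧ ∀ s : K, g (s • u) = ψ s • g u := by
  choose ψ hψ using hg.exists_map_smul hB hu hu0
  have injective := smul_left_injective K (g.map_ne_zero_iff.2 hu0)
  refine ⟨AddMonoidHom.mk' ψ fun s t => injective ?_, injective ?_, hψ⟩
  · simp only [add_smul, ← hψ, map_add]
  · simp only [AddMonoidHom.mk'_apply, ← hψ, one_smul]

/-- `x • u + (1 - x) • v + (x ^ 2 - x) • w` is null, and its image is null only if
`ψ (x ^ 2) = ψ x ^ 2`; in characteristic other than two this makes `ψ` multiplicative. -/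
theorem exists_ringHom (hB : IsLorentzian B) (hg : PreservesNull B g.toEquiv)
    (h : NullTriple B u v w) : ∃ ψ : K →+* K, ∀ s : K, g (s • u) = ψ s • g u := by
  obtain ⟨ψ, hψ1, hψ⟩ := hg.exists_addMonoidHom hB h.null_fst h.fst_ne_zero
  have hψv (s : K) : g (s • v) = ψ s • g v :=
    hg.map_smul_congr hB h.null_snd h.null_trd (h.snd_trd.trans h.fst_trd.symm)
      (h.fst_trd ▸ h.ne_zero) (hψ s)
  have hψw (s : K) : g (s • w) = ψ s • g w :=
    hg.map_smul_congr hB h.null_trd h.null_snd (by rw [hB.isSymm.eq w, h.snd_trd]) h.ne_zero (hψ s)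
  have map_mul_self (x : K) : ψ (x * x) = ψ x * ψ x := by
    have hnull : B (x • u + (1 - x) • v + (x * x - x) • w)
        (x • u + (1 - x) • v + (x * x - x) • w) = 0 := by
      rw [h.apply_combination_self hB.isSymm]
      ring
    have h' := hg.nullTriple_map hB h
    rw [← hg.map_null_iff, map_add g, map_add g, hψ, hψv, hψw, h'.apply_combination_self hB.isSymm,
      map_sub, map_sub, hψ1] at hnull
    have := (mul_eq_zero.1 hnull).resolve_left (mul_ne_zero two_ne_zero h'.ne_zero)
    linear_combination this
  exact ⟨ψ.mkRingHomOfMulSelfOfTwoNeZero map_mul_self two_ne_zero hψ1, hψ⟩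

theorem exists_semilinear (hB : IsLorentzian B) (hg : PreservesNull B g.toEquiv) :
    ∃ ψ : K →+* K, ∀ (s : K) (x : V), g (s • x) = ψ s • g x := by
  obtain ⟨u, v, w, h⟩ := hB.exists_nullTriple
  obtain ⟨ψ, hψ⟩ := hg.exists_ringHom hB h
  refine ⟨ψ, fun s x => ?_⟩
  induction x using hB.induction_null h.null_snd (h.rotate hB.isSymm).fst_ne_zero with
  | null n hn hnv =>
    set m := (B u v / B n v) • n with hm
    have hmn : n = (B n v / B u v) • m := by
      rw [hm, smul_smul, div_mul_div_cancel₀ h.ne_zero, div_self hnv, one_smul]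
    have hψm (r : K) : g (r • m) = ψ r • g m :=
      hg.map_smul_congr hB (by simp [hm, hn]) h.null_snd (by simp [hm, hnv]) h.ne_zero (hψ r)
    rw [hmn, smul_smul, hψm, hψm, smul_smul, map_mul]
  | add x y hx hy => simp only [smul_add, map_add, hx, hy]
  | neg x hx => simp only [smul_neg, map_neg, hx]

theorem mul_apply_map (hB : IsLorentzian B) (hg : PreservesNull B g.toEquiv)
    (hψ : ∀ (s : K) (x : V), g (s • x) = ψ s • g x) {n : V} (hn : B n n = 0) (x z : V) :
    ψ (B z n) * B (g x) (g n) = ψ (B x n) * B (g z) (g n) := by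
  have := hg.apply_map_congr hB hn (u := B z n • x) (v := B x n • z) (by simp [mul_comm])
  simpa [hψ] using this

theorem exists_apply_map (hB : IsLorentzian B) (hg : PreservesNull B g.toEquiv)
    (hψ : ∀ (s : K) (x : V), g (s • x) = ψ s • g x) :
    ∃ κ ≠ 0, ∀ x y, B (g x) (g y) = κ * ψ (B x y) := by
  obtain ⟨v, u, w, h⟩ := hB.exists_nullTriple
  have hψvu : ψ (B v u) ≠ 0 := (map_ne_zero ψ).2 h.ne_zero
  set κ := B (g v) (g u) / ψ (B v u) with hκ
  have apply_map_u (x : V) : B (g x) (g u) = κ * ψ (B x u) := by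
    rw [hκ, div_mul_eq_mul_div, eq_div_iff hψvu, mul_comm, hg.mul_apply_map hB hψ h.null_snd x v,
      mul_comm]
  refine ⟨κ, div_ne_zero (hg.nullTriple_map hB h).ne_zero hψvu, fun x y => ?_⟩
  induction y using hB.induction_null h.null_snd (h.rotate hB.isSymm).fst_ne_zero with
  | null n hn hnu =>
    have hψun : ψ (B u n) ≠ 0 := (map_ne_zero ψ).2 (hB.isSymm.eq n u ▸ hnu)
    refine mul_left_cancel₀ hψun ?_
    rw [hg.mul_apply_map hB hψ hn x u, hB.isSymm.eq (g u), apply_map_u, hB.isSymm.eq n u]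
    ring
  | add y z hy hz => simp only [map_add, hy, hz, mul_add]
  | neg y hy => simp only [map_neg, hy, mul_neg]

end AddEquiv

end PreservesNull

/-- An additive bijection that multiplies the form by `κ`, up to the field endomorphism `ψ`; this
is the linear part of a transformation preserving light cones. -/
def IsSemisimilitude (B : LinearMap.BilinForm K V) (g : V ≃+ V) (ψ : K →+* K) (κ : K) : Prop :=
  ∀ x y, B (g x) (g y) = κ * ψ (B x y)

theorem IsSemisimilitude.apply_left {g : V ≃+ V} {ψ : K →+* K} {κ : K}
    (hg : IsSemisimilitude B g ψ κ) (x y : V) : B (g x) y = κ * ψ (B x (g.symm y)) := by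
  rw [← hg, g.apply_symm_apply]

theorem PreservesNull.exists_isSemisimilitude [NeZero (2 : K)] {f : V ≃ V} (hB : IsLorentzian B)
    (hf : PreservesNull B f) : ∃ (g : V ≃+ V) (ψ : K →+* K) (κ : K),
      κ ≠ 0 ∧ (∀ x y, f x - f y = g (x - y)) ∧ IsSemisimilitude B g ψ κ := by
  obtain ⟨g, hfg⟩ := hf.exists_addEquiv hB
  have hg : PreservesNull B g.toEquiv := fun x y => by
    change B (g x - g y) (g x - g y) = 0 ↔ _
    rw [← map_sub, ← hfg, hf]
  obtain ⟨ψ, hψ⟩ := hg.exists_semilinear hB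
  obtain ⟨κ, hκ, hκψ⟩ := hg.exists_apply_map hB hψ
  exact ⟨g, ψ, κ, hκ, hfg, hκψ⟩

end Lorentzian

section Minkowski

variable {Q : Type*} [Field Q]

/-- The Minkowski inner product with speed of light `c`. Its null vectors are the displacements
covered at speed `c`. -/
def minkowski (c : Q) : LinearMap.BilinForm Q (Coord Q) :=
  LinearMap.mk₂ Q (fun x y => x 0 * y 0 + x 1 * y 1 + x 2 * y 2 - c ^ 2 * (x 3 * y 3))
    (fun _ _ _ => by simp only [Pi.add_apply]; ring)
    (fun _ _ _ => by simp only [Pi.smul_apply, smul_eq_mul]; ring)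
    (fun _ _ _ => by simp only [Pi.add_apply]; ring)
    (fun _ _ _ => by simp only [Pi.smul_apply, smul_eq_mul]; ring)

theorem minkowski_apply (c : Q) (x y : Coord Q) :
    minkowski c x y = x 0 * y 0 + x 1 * y 1 + x 2 * y 2 - c ^ 2 * (x 3 * y 3) :=
  rfl

theorem minkowski_isSymm (c : Q) : (minkowski c).IsSymm :=
  ⟨fun x y => by simp only [minkowski_apply]; ring⟩

theorem minkowski_oneT (c : Q) (x : Coord Q) : minkowski c x oneT = -c ^ 2 * x 3 := by
  simp [minkowski_apply, oneT]

theorem nullTriple_minkowski [NeZero (2 : Q)] {c : Q} (hc : c ≠ 0) :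
    NullTriple (minkowski c) ![c, 0, 0, 1] ![0, c, 0, 1] ![0, 0, c, 1] where
  null_fst := by simp [minkowski_apply, sq]
  null_snd := by simp [minkowski_apply, sq]
  null_trd := by simp [minkowski_apply, sq]
  ne_zero := by simp [minkowski_apply, hc]
  fst_trd := by simp [minkowski_apply]
  snd_trd := by simp [minkowski_apply]

variable [LinearOrder Q] [IsStrictOrderedRing Q] {c : Q} {x y : Coord Q}

theorem minkowski_self_nonneg (hx : x 3 = 0) : 0 ≤ minkowski c x x := by
  rw [minkowski_apply, hx, mul_zero, mul_zero, sub_zero]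
  exact add_nonneg (add_nonneg (mul_self_nonneg _) (mul_self_nonneg _)) (mul_self_nonneg _)

theorem eq_zero_of_minkowski_self_eq_zero (hx : x 3 = 0) (h : minkowski c x x = 0) : x = 0 := by
  rw [minkowski_apply, hx, mul_zero, mul_zero, sub_zero] at h
  obtain ⟨h₀₁, h₂⟩ := (add_eq_zero_iff_of_nonneg
    (add_nonneg (mul_self_nonneg _) (mul_self_nonneg _)) (mul_self_nonneg _)).1 h
  obtain ⟨h₀, h₁⟩ := (add_eq_zero_iff_of_nonneg (mul_self_nonneg _) (mul_self_nonneg _)).1 h₀₁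
  ext k
  fin_cases k
  exacts [mul_self_eq_zero.1 h₀, mul_self_eq_zero.1 h₁, mul_self_eq_zero.1 h₂, hx]

theorem isLorentzian_minkowski (hc : c ≠ 0) : IsLorentzian (minkowski c) where
  isSymm := minkowski_isSymm c
  exists_eq_smul u v hu0 hu hv hvu := by
    have hu3 : u 3 ≠ 0 := fun h => hu0 (eq_zero_of_minkowski_self_eq_zero h hu)
    refine ⟨v 3 / u 3, ?_⟩
    rw [← sub_eq_zero, sub_eq_add_neg, ← neg_smul]
    refine eq_zero_of_minkowski_self_eq_zero (c := c) (by simp [hu3]) ?_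
    rw [apply_add_smul_self (minkowski_isSymm c) hu, hv, hvu, mul_zero, add_zero]
  exists_nullTriple := ⟨_, _, _, nullTriple_minkowski hc⟩

theorem minkowski_ne_zero_of_timelike (hx : minkowski c x x < 0) (hy : minkowski c y y < 0) :
    minkowski c x y ≠ 0 := by
  intro hxy
  have hy3 : y 3 ≠ 0 := fun h => hy.not_ge (minkowski_self_nonneg h)
  have simultaneous := minkowski_self_nonneg (c := c) (x := y 3 • x - x 3 • y) (by simp [mul_comm])
  simp only [apply_sub_self (minkowski_isSymm c), map_smul, LinearMap.smul_apply, smul_eq_mul,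
    hxy] at simultaneous
  linarith [mul_neg_of_pos_of_neg (mul_self_pos.2 hy3) hx,
    mul_nonpos_of_nonneg_of_nonpos (mul_self_nonneg (x 3)) hy.le]

theorem exists_simultaneous_orthogonal (c : Q) (z : Coord Q) :
    ∃ n : Coord Q, n 3 = 0 ∧ minkowski c n z = 0 ∧ 0 < minkowski c n n := by
  by_cases hz : z 0 = 0
  · exact ⟨![1, 0, 0, 0], by simp, by simp [minkowski_apply, hz], by simp [minkowski_apply]⟩
  · refine ⟨![z 1, -z 0, 0, 0], by simp, ?_, ?_⟩
    · simp [minkowski_apply, mul_comm]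
    · have := mul_self_pos.2 hz
      simpa [minkowski_apply] using add_pos_of_nonneg_of_pos (mul_self_nonneg (z 1)) this

theorem dist_nonneg (hQ : AxEField Q) (x y : Coord Q) : 0 ≤ dist x y :=
  (sqrt_spec hQ (by positivity)).1

theorem dist_sq (hQ : AxEField Q) (c : Q) (x y : Coord Q) :
    dist x y ^ 2 = minkowski c (x - y) (x - y) + (c * time x y) ^ 2 := by
  rw [dist, (sqrt_spec hQ (by positivity)).2, minkowski_apply, time, mul_pow, sq_abs]
  simp only [Pi.sub_apply]
  ring

theorem dist_eq_mul_time_iff (hQ : AxEField Q) (hc : 0 ≤ c) :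
    dist x y = c * time x y ↔ minkowski c (x - y) (x - y) = 0 := by
  have htime : 0 ≤ time x y := abs_nonneg _
  rw [← pow_left_inj₀ (dist_nonneg hQ x y) (mul_nonneg hc htime) two_ne_zero,
    dist_sq hQ c, add_eq_right]

theorem dist_eq_dist_iff (hQ : AxEField Q) (c : Q) {x' y' : Coord Q} (h : time x y = 0)
    (h' : time x' y' = 0) : dist x y = dist x' y' ↔
      minkowski c (x - y) (x - y) = minkowski c (x' - y') (x' - y') := by
  rw [← pow_left_inj₀ (dist_nonneg hQ x y) (dist_nonneg hQ x' y') two_ne_zero,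
    dist_sq hQ c, dist_sq hQ c, h, h', add_left_inj]

end Minkowski

section EuclideanField

variable {Q : Type*} [Field Q] [LinearOrder Q] [IsStrictOrderedRing Q]

theorem map_pos_of_axEField (hQ : AxEField Q) (ψ : Q →+* Q) {x : Q} (hx : 0 < x) : 0 < ψ x := by
  obtain ⟨y, rfl⟩ := hQ x hx
  rw [map_pow]
  exact sq_pos_of_ne_zero ((map_ne_zero ψ).2 (by rintro rfl; simp at hx))

theorem strictMono_of_axEField (hQ : AxEField Q) (ψ : Q →+* Q) : StrictMono ψ := fun x y h => by
  simpa using map_pos_of_axEField hQ ψ (sub_pos.2 h)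

theorem map_abs_of_axEField (hQ : AxEField Q) (ψ : Q →+* Q) (x : Q) : ψ |x| = |ψ x| := by
  have mono := (strictMono_of_axEField hQ ψ).monotone
  rcases le_total 0 x with hx | hx
  · rw [abs_of_nonneg hx, abs_of_nonneg (by simpa using mono hx)]
  · rw [abs_of_nonpos hx, map_neg, abs_of_nonpos (by simpa using mono hx)]

theorem eq_id_of_forall_pos {ψ : Q →+* Q} (h : ∀ x, 0 < x → ψ x = x) : ψ = RingHom.id Q := by
  ext x
  rcases lt_trichotomy x 0 with hx | rfl | hx
  · simpa using h (-x) (neg_pos.2 hx)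
  · simp
  · exact h x hx

theorem eq_id_of_forall_pos_apply_apply (hQ : AxEField Q) {ψ : Q →+* Q}
    (h : ∀ x, 0 < x → ψ (ψ x) = x) : ψ = RingHom.id Q := by
  refine eq_id_of_forall_pos fun x hx => ?_
  have mono := strictMono_of_axEField hQ ψ
  rcases lt_trichotomy (ψ x) x with hlt | heq | hgt
  · exact absurd (mono hlt) (by rw [h x hx]; exact hlt.not_gt)
  · exact heq
  · exact absurd (mono hgt) (by rw [h x hx]; exact hgt.not_gt)

end EuclideanField

section Symmetry

variable {Q : Type*} [Field Q] [LinearOrder Q]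

/-- The symmetric time axiom for a single worldview transformation `w`: the two observers see each
other's clocks slowed down by the same rate. -/
def SymTime (w : Coord Q ≃ Coord Q) : Prop :=
  ∀ t : Q, time (w (t • oneT)) (w 0) = time (w.symm (t • oneT)) (w.symm 0)

/-- The symmetric distance axiom for a single worldview transformation `w`: distances of events
simultaneous for both observers are preserved. -/
def SymDist (w : Coord Q ≃ Coord Q) : Prop :=
  ∀ x y, time x y = 0 → time (w x) (w y) = 0 → dist x y = dist (w x) (w y)

variable [IsStrictOrderedRing Q] {w : Coord Q ≃ Coord Q} {g : Coord Q ≃+ Coord Q} {ψ : Q →+* Q}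
  {c κ : Q}

theorem symTime_iff_of_sub (hc : c ≠ 0) (hw : ∀ x y, w x - w y = g (x - y)) :
    SymTime w ↔ ∀ t : Q, |minkowski c (g (t • oneT)) oneT| =
      |minkowski c (g.symm (t • oneT)) oneT| := by
  have hw' (x y : Coord Q) : w.symm x - w.symm y = g.symm (x - y) := by
    rw [g.eq_symm_apply, ← hw, w.apply_symm_apply, w.apply_symm_apply]
  have hc2 : |-c ^ 2| ≠ 0 := by simpa using hc
  simp only [SymTime, time, ← Pi.sub_apply, hw, hw', sub_zero, minkowski_oneT, abs_mul,
    mul_right_inj' hc2]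

theorem symDist_iff_of_sub (hQ : AxEField Q) (c : Q) (hw : ∀ x y, w x - w y = g (x - y)) :
    SymDist w ↔ ∀ z : Coord Q, z 3 = 0 → g z 3 = 0 →
      minkowski c z z = minkowski c (g z) (g z) := by
  have time_eq_zero_iff (x y : Coord Q) : time x y = 0 ↔ (x - y) 3 = 0 := by
    rw [time, abs_eq_zero, Pi.sub_apply]
  constructor
  · intro h z hz hgz
    have hz' : time z 0 = 0 := by rwa [time_eq_zero_iff, sub_zero]
    have hgz' : time (w z) (w 0) = 0 := by rwa [time_eq_zero_iff, hw, sub_zero]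
    simpa [hw] using (dist_eq_dist_iff hQ c hz' hgz').1 (h z 0 hz' hgz')
  · intro h x y hxy hwxy
    rw [dist_eq_dist_iff hQ c hxy hwxy, hw]
    rw [time_eq_zero_iff] at hxy hwxy
    exact h _ hxy (hw x y ▸ hwxy)

namespace IsSemisimilitude

theorem factor_pos (hκ : κ ≠ 0) (hg : IsSemisimilitude (minkowski c) g ψ κ) : 0 < κ := by
  by_contra! hκ'
  refine minkowski_ne_zero_of_timelike (c := c) (x := g ![1, 0, 0, 0]) (y := g ![0, 1, 0, 0])
    ?_ ?_ ?_ <;> rw [hg]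
  · simpa [minkowski_apply] using hκ'.lt_of_ne hκ
  · simpa [minkowski_apply] using hκ'.lt_of_ne hκ
  · simp [minkowski_apply]

theorem minkowski_map_oneT_ne_zero (hQ : AxEField Q) (hc : c ≠ 0) (hκ : 0 < κ)
    (hg : IsSemisimilitude (minkowski c) g ψ κ) : minkowski c (g oneT) oneT ≠ 0 := by
  have oneT_timelike : minkowski c oneT oneT < 0 := by
    rw [minkowski_oneT]
    simpa [oneT] using sq_pos_of_ne_zero hc
  refine minkowski_ne_zero_of_timelike ?_ oneT_timelike
  rw [hg]
  exact mul_neg_of_pos_of_neg hκ (by simpa using strictMono_of_axEField hQ ψ oneT_timelike)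

theorem abs_apply_left (hQ : AxEField Q) (hκ : 0 < κ)
    (hg : IsSemisimilitude (minkowski c) g ψ κ) (x y : Coord Q) :
    |minkowski c (g x) y| = κ * ψ |minkowski c x (g.symm y)| := by
  rw [hg.apply_left, abs_mul, abs_of_pos hκ, map_abs_of_axEField hQ]

/-- Let `e = oneT` and let `m` be the absolute value of the product of `e` and `g e`. Symmetry for
clocks run for time `t` says `κ ψ (κ ψ (t m)) = t m`, and for `t = 1` it says `κ ψ m = m`, so
that `ψ` is an involution. -/
theorem eq_id_of_symTime (hQ : AxEField Q) (hc : c ≠ 0) (hκ : 0 < κ)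
    (hg : IsSemisimilitude (minkowski c) g ψ κ)
    (h : ∀ t : Q, |minkowski c (g (t • oneT)) oneT| = |minkowski c (g.symm (t • oneT)) oneT|) :
    ψ = RingHom.id Q ∧ κ = 1 := by
  set m := |minkowski c oneT (g oneT)| with hm
  have hm0 : m ≠ 0 := by
    rw [hm, abs_ne_zero, (minkowski_isSymm c).eq]
    exact hg.minkowski_map_oneT_ne_zero hQ hc hκ
  have at_one : m = |minkowski c oneT (g.symm oneT)| := by
    simpa only [one_smul, hm, (minkowski_isSymm c).eq] using h 1
  have map_m : κ * ψ m = m := by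
    nth_rw 1 [at_one]
    rw [← hg.abs_apply_left hQ hκ, hm, (minkowski_isSymm c).eq]
  have at_pos (t : Q) (ht : 0 < t) : κ * ψ (κ * ψ (t * m)) = t * m := by
    have forward : |minkowski c (g (t • oneT)) oneT| = κ * ψ (t * m) := by
      rw [hg.abs_apply_left hQ hκ, map_smul, LinearMap.smul_apply, smul_eq_mul, abs_mul,
        abs_of_pos ht, at_one]
    have backward := hg.abs_apply_left hQ hκ (g.symm (t • oneT)) (g oneT)
    rw [g.apply_symm_apply, g.symm_apply_apply, ← h, forward, map_smul, LinearMap.smul_apply,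
      smul_eq_mul, abs_mul, abs_of_pos ht] at backward
    exact backward.symm
  have hψ : ψ = RingHom.id Q := by
    refine eq_id_of_forall_pos_apply_apply hQ fun t ht => mul_right_cancel₀ hm0 ?_
    calc ψ (ψ t) * m = ψ (ψ t) * (κ * ψ m) := by rw [map_m]
      _ = κ * ψ (ψ t * (κ * ψ m)) := by rw [map_m, map_mul, mul_left_comm, map_m]
      _ = κ * ψ (κ * ψ (t * m)) := by rw [map_mul ψ t, mul_left_comm]
      _ = t * m := at_pos t ht
  refine ⟨hψ, mul_right_cancel₀ hm0 ?_⟩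
  simpa [hψ] using map_m

theorem eq_id_of_symDist (hQ : AxEField Q) (hc : c ≠ 0)
    (hg : IsSemisimilitude (minkowski c) g ψ κ) (h : ∀ z : Coord Q, z 3 = 0 → g z 3 = 0 →
      minkowski c z z = minkowski c (g z) (g z)) : ψ = RingHom.id Q ∧ κ = 1 := by
  obtain ⟨n, hn3, hn, hnn⟩ := exists_simultaneous_orthogonal c (g.symm oneT)
  have map_pos (r : Q) (hr : 0 < r) : r = κ * ψ r := by
    obtain ⟨s, hs⟩ := hQ (r / minkowski c n n) (div_pos hr hnn)
    have hr' : minkowski c (s • n) (s • n) = r := by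
      simp only [map_smul, LinearMap.smul_apply, smul_eq_mul]
      rw [← mul_assoc, ← sq, ← hs, div_mul_cancel₀ _ hnn.ne']
    have hg3 : g (s • n) 3 = 0 := by
      have := hg.apply_left (s • n) oneT
      rw [map_smul (minkowski c), LinearMap.smul_apply, hn, smul_zero, map_zero, mul_zero,
        minkowski_oneT] at this
      simpa [hc] using this
    rw [← hr', ← hg]
    exact h _ (by simp [hn3]) hg3
  have hκ : κ = 1 := by simpa using (map_pos 1 one_pos).symm
  exact ⟨eq_id_of_forall_pos fun r hr => by simpa [hκ] using (map_pos r hr).symm, hκ⟩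

theorem symTime_iff_eq_id (hQ : AxEField Q) (hc : c ≠ 0) (hκ : κ ≠ 0)
    (hg : IsSemisimilitude (minkowski c) g ψ κ) (hw : ∀ x y, w x - w y = g (x - y)) :
    SymTime w ↔ ψ = RingHom.id Q ∧ κ = 1 := by
  rw [symTime_iff_of_sub hc hw]
  refine ⟨hg.eq_id_of_symTime hQ hc (hg.factor_pos hκ), ?_⟩
  rintro ⟨rfl, rfl⟩ t
  have adjoint (x y : Coord Q) : minkowski c (g x) y = minkowski c x (g.symm y) := by
    simpa using hg.apply_left x y
  have symm := (minkowski_isSymm c).eq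
  congr 1
  calc minkowski c (g (t • oneT)) oneT
      = t * minkowski c oneT (g.symm oneT) := by
        rw [adjoint, map_smul, LinearMap.smul_apply, smul_eq_mul]
    _ = t * minkowski c oneT (g oneT) := by rw [← adjoint, symm]
    _ = minkowski c (g.symm (t • oneT)) oneT := by
        rw [symm (g.symm _), ← adjoint, map_smul, smul_eq_mul, symm oneT]

theorem symDist_iff_eq_id (hQ : AxEField Q) (hc : c ≠ 0)
    (hg : IsSemisimilitude (minkowski c) g ψ κ) (hw : ∀ x y, w x - w y = g (x - y)) :
    SymDist w ↔ ψ = RingHom.id Q ∧ κ = 1 := by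
  rw [symDist_iff_of_sub hQ c hw]
  refine ⟨hg.eq_id_of_symDist hQ hc, ?_⟩
  rintro ⟨rfl, rfl⟩ z - -
  rw [hg, RingHom.id_apply, one_mul]

end IsSemisimilitude

theorem symTime_iff_symDist (hQ : AxEField Q) (hc : c ≠ 0) (hw : PreservesNull (minkowski c) w) :
    SymTime w ↔ SymDist w := by
  obtain ⟨g, ψ, κ, hκ, hwg, hg⟩ := hw.exists_isSemisimilitude (isLorentzian_minkowski hc)
  rw [hg.symTime_iff_eq_id hQ hc hκ hwg, hg.symDist_iff_eq_id hQ hc hwg]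

end Symmetry

namespace Frame

section Photons

variable {B Q : Type*} [Field Q] {M : Frame B Q} {i j : B} {c d : Q}

/-- `M.IsLightSpeed i c` says that `c` is the speed of light `c_i` of `AxPh`, with `dist` and
`time` combined into the Minkowski form. -/
structure IsLightSpeed [LinearOrder Q] (M : Frame B Q) (i : B) (c : Q) : Prop where
  pos : 0 < c
  exists_iff : ∀ x y, (∃ p ∈ M.Ph, x ∈ M.wline i p ∧ y ∈ M.wline i p) ↔
    minkowski c (x - y) (x - y) = 0

variable [LinearOrder Q] [IsStrictOrderedRing Q]

theorem AxPh.exists_isLightSpeed (hPh : M.AxPh) (hQ : AxEField Q) (hi : i ∈ M.IOb) :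
    ∃ c, M.IsLightSpeed i c := by
  obtain ⟨c, hc, h⟩ := hPh i hi
  exact ⟨c, hc, fun x y => (h x y).trans (dist_eq_mul_time_iff hQ hc.le)⟩

namespace IsLightSpeed

theorem isLorentzian (hi : M.IsLightSpeed i c) : IsLorentzian (minkowski c) :=
  isLorentzian_minkowski hi.pos.ne'

theorem collinear_wline (hi : M.IsLightSpeed i c) {p : B} (hp : p ∈ M.Ph) {x y : Coord Q}
    (hx : x ∈ M.wline i p) (hy : y ∈ M.wline i p) (hxy : x ≠ y) : Collinear Q (M.wline i p) := by
  refine (collinear_iff_of_mem hx).2 ⟨y - x, fun z hz => ?_⟩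
  have null_sub {a b : Coord Q} (ha : a ∈ M.wline i p) (hb : b ∈ M.wline i p) :
      minkowski c (a - b) (a - b) = 0 := (hi.exists_iff a b).1 ⟨p, hp, ha, hb⟩
  obtain ⟨s, hs⟩ := hi.isLorentzian.exists_eq_smul_of_null_sub (null_sub hy hx)
    (sub_ne_zero.2 hxy.symm) (null_sub hz hx) (by simpa using null_sub hz hy)
  exact ⟨s, by rw [← hs, vadd_eq_add, sub_add_cancel]⟩

theorem hasSpeed_iff (hi : M.IsLightSpeed i c) (hQ : AxEField Q) {p : B} (hp : p ∈ M.Ph)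
    (hne : (M.wline i p).Nontrivial) {v : Q} : M.HasSpeed i p v ↔ v = c := by
  have dist_eq {x y : Coord Q} (hx : x ∈ M.wline i p) (hy : y ∈ M.wline i p) :
      dist x y = c * time x y :=
    (dist_eq_mul_time_iff hQ hi.pos.le).2 ((hi.exists_iff x y).1 ⟨p, hp, hx, hy⟩)
  constructor
  · rintro ⟨-, x, hx, y, hy, hxy, hv⟩
    have time_ne_zero : time x y ≠ 0 := fun h => hxy <| sub_eq_zero.1 <|
      eq_zero_of_minkowski_self_eq_zero (abs_eq_zero.1 h) ((hi.exists_iff x y).1 ⟨p, hp, hx, hy⟩)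
    exact mul_right_cancel₀ time_ne_zero (hv.symm.trans (dist_eq hx hy))
  · rintro rfl
    obtain ⟨x, hx, y, hy, hxy⟩ := hne
    exact ⟨hi.collinear_wline hp hx hy hxy, x, hx, y, hy, hxy, dist_eq hx hy⟩

theorem exists_nontrivial_wline (hi : M.IsLightSpeed i c) :
    ∃ p ∈ M.Ph, (M.wline i p).Nontrivial := by
  have h := nullTriple_minkowski hi.pos.ne'
  obtain ⟨p, hp, hx, hy⟩ := (hi.exists_iff ![c, 0, 0, 1] 0).2 (by simpa using h.null_fst)
  exact ⟨p, hp, _, hx, _, hy, h.fst_ne_zero⟩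

theorem eq_of_axSameC (hi : M.IsLightSpeed i c) (hj : M.IsLightSpeed j d) (hQ : AxEField Q)
    (hc : M.AxSameC) (hiO : i ∈ M.IOb) (hjO : j ∈ M.IOb) : c = d := by
  obtain ⟨p, hp, hne⟩ := hi.exists_nontrivial_wline
  have speed : M.HasSpeed j p c := (hc i hiO j hjO p hp c).1 ((hi.hasSpeed_iff hQ hp hne).2 rfl)
  have ⟨_, x, hx, y, hy, hxy, _⟩ := speed
  exact (hj.hasSpeed_iff hQ hp ⟨x, hx, y, hy, hxy⟩).1 speed

theorem ev_injective (hi : M.IsLightSpeed i c) : Function.Injective (M.ev i) := fun x y hxy =>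
  hi.isLorentzian.eq_of_forall_null fun z hz => by
    obtain ⟨p, hp, hz, hx⟩ := (hi.exists_iff z x).2 hz
    have hy : p ∈ M.ev i y := hxy ▸ hx
    exact (hi.exists_iff z y).1 ⟨p, hp, hz, hy⟩

end IsLightSpeed

end Photons

section Worldview

variable {B Q : Type*} {M : Frame B Q} {i j : B} {w : Coord Q ≃ Coord Q}

/-- `M.IsWorldview i j w` says that the relation `w_{ij}` is the graph of the bijection `w`. -/
def IsWorldview (M : Frame B Q) (i j : B) (w : Coord Q ≃ Coord Q) : Prop :=
  ∀ x x', M.wvt i j x x' ↔ w x = x'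

theorem AxEv.exists_isWorldview (hEv : M.AxEv) (hi : i ∈ M.IOb) (hj : j ∈ M.IOb)
    (hi' : Function.Injective (M.ev i)) (hj' : Function.Injective (M.ev j)) :
    ∃ w, M.IsWorldview i j w := by
  choose f hf using hEv i hi j hj
  choose g hg using hEv j hj i hi
  refine ⟨⟨f, g, fun x => hi' ?_, fun x => hj' ?_⟩, fun x x' => ?_⟩
  · rw [← hg, ← hf]
  · rw [← hf, ← hg]
  · change M.ev i x = M.ev j x' ↔ f x = x'
    rw [hf, hj'.eq_iff]

namespace IsWorldview

theorem symm (hw : M.IsWorldview i j w) : M.IsWorldview j i w.symm := fun x x' => by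
  rw [w.symm_apply_eq, eq_comm (a := x), ← hw, wvt, wvt, eq_comm]

theorem mem_wline_iff (hw : M.IsWorldview i j w) {p : B} {x : Coord Q} :
    w x ∈ M.wline j p ↔ x ∈ M.wline i p := by
  have hev : M.ev i x = M.ev j (w x) := (hw x _).2 rfl
  exact Set.ext_iff.1 hev.symm p

variable [Field Q] [LinearOrder Q]

theorem preservesNull (hw : M.IsWorldview i j w) {c : Q} (hi : M.IsLightSpeed i c)
    (hj : M.IsLightSpeed j c) : PreservesNull (minkowski c) w := fun x y => by
  rw [← hi.exists_iff x y, ← hj.exists_iff]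
  simp only [hw.mem_wline_iff]

theorem symTime_iff (hw : M.IsWorldview i j w) :
    (∀ (t : Q) (a b a' b' : Coord Q), M.wvt i j (t • oneT) a → M.wvt i j 0 b →
      M.wvt j i (t • oneT) a' → M.wvt j i 0 b' → time a b = time a' b') ↔ SymTime w := by
  simp only [hw _ _, hw.symm _ _, SymTime]
  exact ⟨fun h t => h t _ _ _ _ rfl rfl rfl rfl, by rintro h t _ _ _ _ rfl rfl rfl rfl; exact h t⟩

theorem symDist_iff (hw : M.IsWorldview i j w) :
    (∀ x y x' y' : Coord Q, M.ev i x = M.ev j x' → M.ev i y = M.ev j y' →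
      time x y = 0 → time x' y' = 0 → dist x y = dist x' y') ↔ SymDist w := by
  have hev (x x' : Coord Q) : M.ev i x = M.ev j x' ↔ w x = x' := hw x x'
  simp only [hev, SymDist]
  exact ⟨fun h x y => h x y _ _ rfl rfl, by rintro h x y _ _ rfl rfl; exact h x y⟩

end IsWorldview

end Worldview

end Frame

end SpecRel

open SpecRel in
theorem proposition4_general {B Q : Type*} [Field Q] [LinearOrder Q] [IsStrictOrderedRing Q]
    (M : Frame B Q) (hQ : AxEField Q) (hPh : M.AxPh) (hEv : M.AxEv) (hc : M.AxSameC) :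
    M.AxSymTime ↔ M.AxSymDist := by
  refine forall₂_congr fun i hi => forall₂_congr fun j hj => ?_
  obtain ⟨c, hci⟩ := hPh.exists_isLightSpeed hQ hi
  obtain ⟨d, hdj⟩ := hPh.exists_isLightSpeed hQ hj
  obtain rfl : c = d := hci.eq_of_axSameC hdj hQ hc hi hj
  obtain ⟨w, hw⟩ := hEv.exists_isWorldview hi hj hci.ev_injective hdj.ev_injective
  exact hw.symTime_iff.trans <|
    (symTime_iff_symDist hQ hci.pos.ne' (hw.preservesNull hci hdj)).trans hw.symDist_iff.symm

theorem proposition4 {B Q : Type*} [Field Q] [LinearOrder Q] [IsStrictOrderedRing Q]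
    (M : SpecRel.Frame B Q) (h₀ : M.SpecRel0) (hc : M.AxSameC) :
    M.AxSymTime ↔ M.AxSymDist :=
  proposition4_general M h₀.axEField h₀.axPh h₀.axEv hc
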